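/- Let $D\ge 2$. A GEM of dimension $D$ and size $m$ is a tuple $(\alpha_1,\dots,\alpha_{D+1})$ of perfect matchings (fixed-point-free involutions) of $[m]=\{1,\dots,m\}$; equivalently, a graph on the vertex set $[m]$ with edges coloured by $D+1$ colours such that every vertex is incident to exactly one edge of each colour. It is connected if this graph is connected. An orientable GEM of dimension $D$ and size $2n$ is a GEM of size $2n$ together with an ordered bipartition $(A,B)$ of its vertices, i.e. $[2n]=A\sqcup B$ and every $\alpha_c$ exchanges $A$ and $B$ (so $|A|=|B|=n$); there are $\binom{2n}{n}(n!)^{D+1}$ of them. A $D$-multiple linear order of size $k$ is a $D$-tuple $(<_1,\dots,<_D)$ of linear orders of $[k]$; it is reducible if there is a partition $[k]=A\sqcup B$ into two nonempty sets such that $a<_j b$ for all $a\in A$, $b\in B$ and all $j$, and irreducible otherwise. Let $\mathfrak{il}_k(D)$ be the number of irreducible $D$-multiple linear orders of size $k$, and $(n)_k=n(n-1)\cdots(n-k+1)$. Let $p_n$ be the probability that a uniformly random orientable GEM of dimension $D$ and size $2n$ is connected. Then, as $n\to\infty$, $$p_n\;\approx\;1-\sum_{k\ge1}\frac{\mathfrak{il}_k(D)}{k!\,\big((n)_k\big)^{D-1}},$$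 in the following sense: with $f_0(n)=1$ and $f_k(n)=-\dfrac{\mathfrak{il}_k(D)}{k!\,((n)_k)^{D-1}}$ for $k\ge1$, one has $p_n=\sum_{k=0}^{r}f_k(n)+O\big(f_{r+1}(n)\big)$ for every $r\ge0$, and $f_{k+1}(n)=o\big(f_k(n)\big)$ for every $k\ge0$. -/

import Mathlib

/-- A GEM of dimension `D` and size `m` on the simplices labeled by `Fin m`: for each colour
`c` among `D + 1` colours, a perfect matching `glue c` of the simplices (a fixed-point-free
involution).  The facet opposite to the vertex of colour `c` of the simplex `i` is glued to the
facet opposite to the vertex of colour `c` of the simplex `glue c i`. -/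
@[ext] structure GEM (D m : ℕ) where
  glue : Fin (D + 1) → Equiv.Perm (Fin m)
  glue_glue : ∀ c i, glue c (glue c i) = i
  glue_ne : ∀ c i, glue c i ≠ i

namespace GEM

/-- The underlying simple graph: two simplices are adjacent if they are glued along
at least one facet. -/
def graph {D m : ℕ} (g : GEM D m) : SimpleGraph (Fin m) where
  Adj i j := ∃ c, g.glue c i = j
  symm := ⟨fun i j ⟨c, h⟩ => ⟨c, by rw [← h, g.glue_glue]⟩⟩
  loopless := ⟨fun i ⟨c, h⟩ => g.glue_ne c i h⟩

/-- A GEM is connected if its graph is connected. -/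
def Connected {D m : ℕ} (g : GEM D m) : Prop := g.graph.Connected

end GEM

/-- An orientable GEM of dimension `D` and size `m`, given with the ordered bipartition
`(A, Aᶜ)` of its simplices: every gluing exchanges `A` and its complement (which
therefore both have `m / 2` elements).  On `2 * n` labels these objects are counted
by `(2n choose n) * (n !) ^ (D + 1)`. -/
@[ext] structure OGEM (D m : ℕ) extends GEM D m where
  A : Set (Fin m)
  glue_mem_iff : ∀ c i, glue c i ∈ A ↔ i ∉ A

instance (D m : ℕ) : Finite (OGEM D m) :=
  Finite.of_injective (fun g : OGEM D m => (g.glue, g.A)) fun g h e => by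
    have e' := Prod.mk.inj e
    exact OGEM.ext e'.1 e'.2

/-- The probability that a uniformly random element of `OGEM D m` is connected. -/
noncomputable def probConnected (D m : ℕ) : ℝ :=
  (Nat.card {g : OGEM D m // g.toGEM.Connected} : ℝ) / (Nat.card (OGEM D m) : ℝ)

/-- A `d`-multiple linear order of size `k`: a `d`-tuple of linear orders of a set
of `k` labels. -/
abbrev MultiLinearOrder (d k : ℕ) : Type := Fin d → LinearOrder (Fin k)

instance (k : ℕ) : Finite (LinearOrder (Fin k)) :=
  Finite.of_injective (fun (l : LinearOrder (Fin k)) => l.lt) fun _ _ e =>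
    LinearOrder.ext_lt fun a b => iff_of_eq (congrFun (congrFun e a) b)

/-- `L` is reducible if the ground set has a partition into two nonempty parts `A`, `Aᶜ` such that
every element of `A` precedes every element of `Aᶜ` in all the orders of `L`. -/
def MultiLinearOrder.Reducible {d k : ℕ} (L : MultiLinearOrder d k) : Prop :=
  ∃ A : Set (Fin k), A.Nonempty ∧ Aᶜ.Nonempty ∧
    ∀ a ∈ A, ∀ b ∈ Aᶜ, ∀ j : Fin d, (L j).lt a b

/-- The number `il_k(d)` of irreducible `d`-multiple linear orders of size `k`. -/
noncomputable def il (d k : ℕ) : ℕ :=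
  Nat.card {L : MultiLinearOrder d k // ¬ L.Reducible}

/-- The asymptotic expansion `a n ≈ ∑_{k ≥ m} f k n` as `n → ∞`. -/
def HasAsymptoticExpansion (a : ℕ → ℝ) (m : ℕ) (f : ℕ → ℕ → ℝ) : Prop :=
  (∀ r, m ≤ r →
    (fun n => a n - ∑ k ∈ Finset.Icc m r, f k n) =O[Filter.atTop] f (r + 1)) ∧
  (∀ k, m ≤ k → f (k + 1) =o[Filter.atTop] f k)

open Asymptotics Filter

/-! Let `d = D - 1`, `g n = (n!) ^ d` and `G = ∑ g n x ^ n`. This one divergent series governs both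
families. Dividing the number of orientable GEMs of size `2n` by `(2n)!` gives `g n`, so the
connected ones have generating series `C = log G`, that is `x G' = (x C') G` (`mul_count`,
`mul_factorial_pow_eq_sum`). Dividing the number `(n!) ^ D` of `D`-multiple orders by `n!` also
gives `g n`, and splitting off the first irreducible block shows that `E = 1 / G` has coefficients
`1` and `-il D k / k!` (`factorial_pow_eq_sum_il`, `sum_ilCoeff`).

Since `g` grows factorially, the coefficients of `log G` are asymptotic to `∑ e k * g (n - k)` with
`e` the coefficients of `d(log G)/dG = 1 / G`; this is `log_coeff_sub_sum_isBigO`, proved directly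
from the recurrence through `logDefect_isBigO`. Dividing by `g n` turns `g (n - k)` into the inverse
power of the falling factorial. Finally `il_pos` makes every coefficient nonzero, so that error
terms can be measured against the next term of the expansion. -/

/-! ### Factorial estimates -/

/-- Raising `t` by one multiplies the left side by `s + t + 1` and the right by the larger `s + t +
u + 1`. Consequence: `j! (n - j)!` increases towards both ends of its range. -/
theorem Nat.factorial_add_mul_factorial_add_le (s t u : ℕ) :
    (s + t).factorial * (s + u).factorial ≤ s.factorial * (s + t + u).factorial := by
  induction t with
  | zero => simp
  | succ t ih =>
    have h1 : (s + (t + 1)).factorial = (s + t + 1) * (s + t).factorial := Nat.factorial_succ _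
    have h2 : (s + (t + 1) + u).factorial = (s + t + u + 1) * (s + t + u).factorial := by
      rw [show s + (t + 1) + u = (s + t + u) + 1 by ring, Nat.factorial_succ]
    rw [h1, h2]
    calc (s + t + 1) * (s + t).factorial * (s + u).factorial
        = (s + t + 1) * ((s + t).factorial * (s + u).factorial) := by ring
      _ ≤ (s + t + u + 1) * (s.factorial * (s + t + u).factorial) :=
        Nat.mul_le_mul (by omega) ih
      _ = _ := by ring

/-- In the sum of `(j! (n - j)!) ^ d` over `s ≤ j ≤ n - s` the two extreme terms dominate. -/
theorem sum_Ico_factorial_pow_le (d : ℕ) (hd : 1 ≤ d) (s n : ℕ) (hn : 2 * s + 1 ≤ n) :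
    ∑ j ∈ Finset.Ico s (n + 1 - s), (j.factorial : ℝ) ^ d * ((n - j).factorial : ℝ) ^ d ≤
      (2 * (s.factorial : ℝ) ^ d + ((s + 1).factorial : ℝ) ^ d * (s + 1)) *
        ((n - s).factorial : ℝ) ^ d := by
  have key : ∀ q j : ℕ, q ≤ j → j + q ≤ n →
      (j.factorial : ℝ) ^ d * ((n - j).factorial : ℝ) ^ d ≤
        (q.factorial : ℝ) ^ d * ((n - q).factorial : ℝ) ^ d := by
    intro q j h1 h2
    rw [← mul_pow, ← mul_pow]
    refine pow_le_pow_left₀ (by positivity) ?_ d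
    have := Nat.factorial_add_mul_factorial_add_le q (j - q) (n - j - q)
    rw [show q + (j - q) = j by omega, show q + (n - j - q) = n - j by omega,
      show j + (n - j - q) = n - q by omega] at this
    exact_mod_cast this
  -- Both end terms equal the target size. The fewer than `n` inner terms are each at most the term
  -- at `s + 1`, which is smaller by a factor of order `n ^ d`; as `1 ≤ d`, this absorbs their
  -- number.
  have hsplit : Finset.Ico s (n + 1 - s) =
      insert s (insert (n - s) (Finset.Ico (s + 1) (n - s))) := by
    ext x; simp only [Finset.mem_Ico, Finset.mem_insert]; omega
  rw [hsplit, Finset.sum_insert (by simp; omega), Finset.sum_insert (by simp)]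
  have h3 : ∑ j ∈ Finset.Ico (s + 1) (n - s),
      (j.factorial : ℝ) ^ d * ((n - j).factorial : ℝ) ^ d ≤
      ((n - s : ℕ) - (s + 1) : ℕ) • (((s + 1).factorial : ℝ) ^ d *
        ((n - (s + 1)).factorial : ℝ) ^ d) := by
    rw [← Nat.card_Ico (s + 1) (n - s)]
    apply Finset.sum_le_card_nsmul
    intro j hj
    rw [Finset.mem_Ico] at hj
    exact key _ _ hj.1 (by omega)
  have h4 : ((n - s : ℕ) - (s + 1) : ℕ) • (((s + 1).factorial : ℝ) ^ d *
        ((n - (s + 1)).factorial : ℝ) ^ d) ≤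
      ((s + 1).factorial : ℝ) ^ d * (s + 1) * ((n - s).factorial : ℝ) ^ d := by
    have e : (n - s).factorial = (n - s) * (n - (s + 1)).factorial := by
      rw [show n - s = (n - (s + 1)) + 1 by omega, Nat.factorial_succ]
    have h5 : ((n - s - (s + 1) : ℕ) : ℝ) ≤ ((n - s : ℕ) : ℝ) ^ d := by
      calc ((n - s - (s + 1) : ℕ) : ℝ) ≤ ((n - s : ℕ) : ℝ) := by exact_mod_cast Nat.sub_le _ _
        _ ≤ ((n - s : ℕ) : ℝ) ^ d :=
          le_self_pow₀ (by exact_mod_cast (by omega : 1 ≤ n - s)) (by omega)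
    rw [nsmul_eq_mul, e]
    push_cast
    rw [mul_pow]
    calc _ ≤ ((n - s : ℕ) : ℝ) ^ d * (((s + 1).factorial : ℝ) ^ d *
        ((n - (s + 1)).factorial : ℝ) ^ d) := by gcongr
      _ = (((s + 1).factorial : ℝ) ^ d * 1) * (((n - s : ℕ) : ℝ) ^ d *
        ((n - (s + 1)).factorial : ℝ) ^ d) := by ring
      _ ≤ _ := by gcongr; linarith [Nat.cast_nonneg (α := ℝ) s]
  have h6 := key s s le_rfl (by omega)
  have h7 := key s (n - s) (by omega) (by omega)
  linarith

/-! ### Coefficients of the logarithm of a factorially divergent series -/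

section Expansion

variable (d : ℕ) (c e : ℕ → ℝ)

/-- The error of the truncated convolution equation satisfied by a formal logarithm. -/
def logDefect (s n : ℕ) : ℝ :=
  ∑ j ∈ Finset.range s, (j.factorial : ℝ) ^ d * c (n - j) - (n.factorial : ℝ) ^ d

variable {d c e}

/-- In `n * ∑ g j * c (n - j)` write `n = j + (n - j)`. The `(n - j)` part is one end of the
recurrence at `n`; in the other part the recurrence is used again for `j * g j`, which produces
defects of order `s - k`. Only the middle of the recurrence at `n` is left over. -/
theorem mul_logDefect (hrec : ∀ n : ℕ, (n : ℝ) * (n.factorial : ℝ) ^ d =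
      ∑ k ∈ Finset.range (n + 1), k * c k * ((n - k).factorial : ℝ) ^ d)
    (s n : ℕ) (hn : 2 * s + 1 ≤ n) :
    (n : ℝ) * logDefect d c s n =
      ∑ k ∈ Finset.range s, k * c k * logDefect d c (s - k) (n - k) -
        ∑ j ∈ Finset.Ico s (n + 1 - s),
          (j.factorial : ℝ) ^ d * (((n - j : ℕ) : ℝ) * c (n - j)) := by
  have h1 : (n : ℝ) * (n.factorial : ℝ) ^ d =
      ∑ j ∈ Finset.range s, (j.factorial : ℝ) ^ d * (((n - j : ℕ) : ℝ) * c (n - j)) +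
      ∑ j ∈ Finset.Ico s (n + 1 - s), (j.factorial : ℝ) ^ d * (((n - j : ℕ) : ℝ) * c (n - j)) +
      ∑ k ∈ Finset.range s, k * c k * ((n - k).factorial : ℝ) ^ d := by
    -- Cut at `k = s`, then reflect the upper part by `j = n - k` and cut it again at `j = s`; the
    -- bound on `n` keeps the two ends disjoint.
    rw [hrec, ← Finset.sum_range_add_sum_Ico _ (show s ≤ n + 1 by omega), add_comm]
    congr 1
    rw [Finset.range_eq_Ico, Finset.sum_Ico_consecutive _ (by omega) (by omega),
      show Finset.Ico s (n + 1) = Finset.Ico (n + 1 - (n + 1 - s)) (n + 1 - 0) by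
        rw [show n + 1 - (n + 1 - s) = s by omega, Nat.sub_zero],
      ← Finset.sum_Ico_reflect _ _ (Nat.sub_le _ _)]
    apply Finset.sum_congr rfl
    intro j hj
    rw [Finset.mem_Ico] at hj
    rw [show n - (n - j) = j by omega]
    ring
  have h2 : ∑ j ∈ Finset.range s, (j * (j.factorial : ℝ) ^ d) * c (n - j) =
      ∑ k ∈ Finset.range s, k * c k *
        ∑ i ∈ Finset.range (s - k), (i.factorial : ℝ) ^ d * c (n - k - i) := by
    have := Finset.sum_range_diag_flip s
      (fun k i => (k * c k) * ((i.factorial : ℝ) ^ d * c (n - k - i)))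
    simp only [Finset.mul_sum]
    rw [← this]
    apply Finset.sum_congr rfl
    intro j _
    rw [hrec, Finset.sum_mul]
    apply Finset.sum_congr rfl
    intro k hk
    rw [Finset.mem_range] at hk
    rw [show n - k - (j - k) = n - j by omega]
    ring
  have h3 : ∑ k ∈ Finset.range s, k * c k * logDefect d c (s - k) (n - k) =
      ∑ j ∈ Finset.range s, (j * (j.factorial : ℝ) ^ d) * c (n - j) -
      ∑ k ∈ Finset.range s, k * c k * ((n - k).factorial : ℝ) ^ d := by
    rw [h2, ← Finset.sum_sub_distrib]
    apply Finset.sum_congr rfl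
    intro k _
    rw [logDefect, mul_sub]
  have h4 : (n : ℝ) * ∑ j ∈ Finset.range s, (j.factorial : ℝ) ^ d * c (n - j) =
      ∑ j ∈ Finset.range s, (j * (j.factorial : ℝ) ^ d) * c (n - j) +
      ∑ j ∈ Finset.range s, (j.factorial : ℝ) ^ d * (((n - j : ℕ) : ℝ) * c (n - j)) := by
    rw [← Finset.sum_add_distrib, Finset.mul_sum]
    apply Finset.sum_congr rfl
    intro j hj
    rw [Finset.mem_range] at hj
    rw [Nat.cast_sub (by omega)]
    ring
  rw [logDefect, mul_sub, h4, h1, h3]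
  ring

/-- Strong induction on `s`: in `mul_logDefect` both the middle sum and the lower defects are `O(n *
g (n - s))`, and the factor `n` is then cancelled. -/
theorem logDefect_isBigO (hd : 1 ≤ d) (hc0 : ∀ n, 0 ≤ c n)
    (hc : ∀ n, c n ≤ (n.factorial : ℝ) ^ d)
    (hrec : ∀ n : ℕ, (n : ℝ) * (n.factorial : ℝ) ^ d =
      ∑ k ∈ Finset.range (n + 1), k * c k * ((n - k).factorial : ℝ) ^ d) (s : ℕ) :
    logDefect d c s =O[atTop] fun n => ((n - s).factorial : ℝ) ^ d := by
  induction s using Nat.strong_induction_on with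
  | _ s ih =>
  have hR : (fun n : ℕ => ∑ j ∈ Finset.Ico s (n + 1 - s),
      (j.factorial : ℝ) ^ d * (((n - j : ℕ) : ℝ) * c (n - j))) =O[atTop]
      fun n => (n : ℝ) * ((n - s).factorial : ℝ) ^ d := by
    apply IsBigO.of_bound (2 * (s.factorial : ℝ) ^ d + ((s + 1).factorial : ℝ) ^ d * (s + 1))
    filter_upwards [eventually_ge_atTop (2 * s + 1)] with n hn
    rw [Real.norm_of_nonneg (Finset.sum_nonneg fun j _ => mul_nonneg (by positivity)
      (mul_nonneg (by positivity) (hc0 _))), Real.norm_of_nonneg (by positivity)]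
    calc _ ≤ ∑ j ∈ Finset.Ico s (n + 1 - s),
          (n : ℝ) * ((j.factorial : ℝ) ^ d * ((n - j).factorial : ℝ) ^ d) := by
          apply Finset.sum_le_sum
          intro j _
          calc (j.factorial : ℝ) ^ d * (((n - j : ℕ) : ℝ) * c (n - j))
              ≤ (j.factorial : ℝ) ^ d * ((n : ℝ) * ((n - j).factorial : ℝ) ^ d) := by
                gcongr
                · exact hc0 _
                · exact_mod_cast Nat.sub_le _ _
                · exact hc _
            _ = _ := by ring
      _ = (n : ℝ) * ∑ j ∈ Finset.Ico s (n + 1 - s),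
          (j.factorial : ℝ) ^ d * ((n - j).factorial : ℝ) ^ d := by rw [Finset.mul_sum]
      _ ≤ (n : ℝ) * ((2 * (s.factorial : ℝ) ^ d + ((s + 1).factorial : ℝ) ^ d * (s + 1)) *
          ((n - s).factorial : ℝ) ^ d) := by
          exact mul_le_mul_of_nonneg_left (sum_Ico_factorial_pow_le d hd s n hn) (by positivity)
      _ = _ := by ring
  have hS : (fun n : ℕ => ∑ k ∈ Finset.range s, k * c k * logDefect d c (s - k) (n - k))
      =O[atTop] fun n => (n : ℝ) * ((n - s).factorial : ℝ) ^ d := by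
    apply IsBigO.fun_sum
    intro k hk
    rw [Finset.mem_range] at hk
    -- The factor `k` kills the only term that involves the defect of order `s` itself.
    rcases Nat.eq_zero_or_pos k with rfl | hk0
    · simpa using isBigO_zero _ _
    · have h := (ih (s - k) (by omega)).comp_tendsto (tendsto_sub_atTop_nat k)
      have h' : (fun n => logDefect d c (s - k) (n - k)) =O[atTop]
          fun n => ((n - s).factorial : ℝ) ^ d := by
        refine h.congr (fun _ => rfl) fun n => ?_
        simp only [Function.comp]
        rw [show n - k - (s - k) = n - s by omega]
      refine (h'.const_mul_left _).trans ?_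
      apply IsBigO.of_bound 1
      filter_upwards [eventually_ge_atTop 1] with n hn
      rw [Real.norm_of_nonneg (by positivity), Real.norm_of_nonneg (by positivity), one_mul]
      exact le_mul_of_one_le_left (by positivity) (by exact_mod_cast hn)
  have hmul : (fun n : ℕ => (n : ℝ) * logDefect d c s n) =O[atTop]
      fun n => (n : ℝ) * ((n - s).factorial : ℝ) ^ d := by
    refine (hS.sub hR).congr' ?_ EventuallyEq.rfl
    filter_upwards [eventually_ge_atTop (2 * s + 1)] with n hn
    rw [mul_logDefect hrec s n hn]
  refine ((isBigO_refl (fun n : ℕ => (n : ℝ)⁻¹) atTop).mul hmul).congr' ?_ ?_ <;>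
  · filter_upwards [eventually_ge_atTop 1] with n hn
    rw [inv_mul_cancel_left₀ (by positivity)]

/-- If `C = log G` with `G = ∑ (n!) ^ d x ^ n` (as `x C' G = x G'`) and `E = 1 / G`, then the
coefficients of `C` have an expansion along the factorials with coefficients those of `E`. -/
theorem log_coeff_sub_sum_isBigO (hd : 1 ≤ d) (hc0 : ∀ n, 0 ≤ c n)
    (hc : ∀ n, c n ≤ (n.factorial : ℝ) ^ d)
    (hrec : ∀ n : ℕ, (n : ℝ) * (n.factorial : ℝ) ^ d =
      ∑ k ∈ Finset.range (n + 1), k * c k * ((n - k).factorial : ℝ) ^ d)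
    (he0 : e 0 = 1)
    (he : ∀ n, 1 ≤ n → ∑ i ∈ Finset.range (n + 1), e i * ((n - i).factorial : ℝ) ^ d = 0)
    (s : ℕ) (hs : 1 ≤ s) :
    (fun n => c n - ∑ i ∈ Finset.range s, e i * ((n - i).factorial : ℝ) ^ d) =O[atTop]
      fun n => ((n - s).factorial : ℝ) ^ d := by
  have h : (fun n => ∑ i ∈ Finset.range s, e i * logDefect d c (s - i) (n - i)) =O[atTop]
      fun n => ((n - s).factorial : ℝ) ^ d := by
    apply IsBigO.fun_sum
    intro k hk
    rw [Finset.mem_range] at hk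
    refine IsBigO.const_mul_left ?_ _
    refine ((logDefect_isBigO hd hc0 hc hrec (s - k)).comp_tendsto
      (tendsto_sub_atTop_nat k)).congr (fun _ => rfl) fun n => ?_
    simp only [Function.comp]
    rw [show n - k - (s - k) = n - s by omega]
  refine h.congr_left fun n => ?_
  -- Regrouping by `m = i + j`, the coefficient of `c (n - m)` is that of `x ^ m` in `E G = 1`, so
  -- only `m = 0` survives.
  have h1 : ∑ i ∈ Finset.range s, e i *
      ∑ j ∈ Finset.range (s - i), (j.factorial : ℝ) ^ d * c (n - i - j) = c n := by
    have := Finset.sum_range_diag_flip s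
      (fun i j => e i * ((j.factorial : ℝ) ^ d * c (n - i - j)))
    simp only [Finset.mul_sum]
    rw [← this]
    have h2 : ∀ m ∈ Finset.range s, ∑ k ∈ Finset.range (m + 1),
        e k * (((m - k).factorial : ℝ) ^ d * c (n - k - (m - k))) =
        if m = 0 then c n else 0 := by
      intro m _
      have h3 : ∑ k ∈ Finset.range (m + 1),
          e k * (((m - k).factorial : ℝ) ^ d * c (n - k - (m - k))) =
          (∑ k ∈ Finset.range (m + 1), e k * ((m - k).factorial : ℝ) ^ d) * c (n - m) := by
        rw [Finset.sum_mul]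
        apply Finset.sum_congr rfl
        intro k hk
        rw [Finset.mem_range] at hk
        rw [show n - k - (m - k) = n - m by omega]
        ring
      rw [h3]
      split_ifs with hm
      · subst hm; simp [he0]
      · rw [he m (by omega), zero_mul]
    rw [Finset.sum_congr rfl h2, Finset.sum_ite_eq' (Finset.range s) 0 (fun _ => c n)]
    simp; omega
  conv_rhs => rw [← h1]
  rw [← Finset.sum_sub_distrib]
  apply Finset.sum_congr rfl
  intro i _
  rw [logDefect, mul_sub]

end Expansion

/-! ### Counting tools -/

theorem Nat.card_eq_sum_of_existsUnique {X Y : Type*} [Finite X] [Fintype Y] (P : X → Y → Prop)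
    (h : ∀ x, ∃! y, P x y) : Nat.card X = ∑ y, Nat.card {x // P x y} := by
  choose f hf hf' using h
  rw [← Nat.card_congr (Equiv.sigmaFiberEquiv f), Nat.card_sigma]
  refine Finset.sum_congr rfl fun y _ => Nat.card_congr (Equiv.subtypeEquivRight fun x => ?_)
  exact ⟨fun e => e ▸ hf x, fun e => (hf' x y e).symm⟩

theorem Finset.sum_univ_apply_card {V : Type*} [Fintype V] {M : Type*} [AddCommMonoid M]
    (f : ℕ → M) : ∑ K : Finset V, f K.card =
      ∑ k ∈ Finset.range (Fintype.card V + 1), (Fintype.card V).choose k • f k := by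
  rw [← Finset.powerset_univ, Finset.sum_powerset_apply_card, Finset.card_univ]

theorem Fintype.card_subtype_notMem {V : Type*} [Fintype V] [DecidableEq V] (K : Finset V) :
    Fintype.card {i // i ∉ K} = Fintype.card V - K.card := by
  rw [Fintype.card_subtype_compl, Fintype.card_coe]

/-! ### Orientable GEMs and their connected components -/

/-- An orientable GEM of dimension `D` on an arbitrary type of simplices. -/
@[ext] structure BipartiteGEM (D : ℕ) (V : Type*) where
  glue : Fin (D + 1) → V → V
  side : V → Prop
  glue_glue : ∀ c i, glue c (glue c i) = i
  side_glue : ∀ c i, side (glue c i) ↔ ¬ side i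

namespace BipartiteGEM

variable {D : ℕ} {V W : Type*}

instance [Finite V] : Finite (BipartiteGEM D V) :=
  Finite.of_injective (fun g : BipartiteGEM D V => (g.glue, g.side)) fun _ _ e => by
    have e' := Prod.mk.inj e
    exact BipartiteGEM.ext e'.1 e'.2

/-- A set of simplices is closed if it is a union of connected components. -/
def IsClosed (g : BipartiteGEM D V) (S : Set V) : Prop := ∀ c i, i ∈ S → g.glue c i ∈ S

/-- The set `K` is a connected component. -/
def IsComponent (g : BipartiteGEM D V) (K : Set V) : Prop :=
  g.IsClosed K ∧ ∀ S ⊆ K, S.Nonempty → g.IsClosed S → S = K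

variable (D) in
/-- Transport of structure along a bijection of the simplices. -/
def congr (e : V ≃ W) : BipartiteGEM D V ≃ BipartiteGEM D W where
  toFun g := ⟨fun c i => e (g.glue c (e.symm i)), fun i => g.side (e.symm i),
    fun c i => by simp [g.glue_glue], fun c i => by simp [g.side_glue]⟩
  invFun g := ⟨fun c i => e.symm (g.glue c (e i)), fun i => g.side (e i),
    fun c i => by simp [g.glue_glue], fun c i => by simp [g.side_glue]⟩
  left_inv g := by ext <;> simp
  right_inv g := by ext <;> simp

theorem isClosed_preimage_congr (e : V ≃ W) (g : BipartiteGEM D V) (S : Set W)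
    (h : (congr D e g).IsClosed S) : g.IsClosed (e ⁻¹' S) := by
  intro c i hi
  have := h c (e i) hi
  simpa [congr] using this

theorem isComponent_univ_congr (e : V ≃ W) (g : BipartiteGEM D V)
    (h : g.IsComponent Set.univ) : (congr D e g).IsComponent Set.univ := by
  refine ⟨fun _ _ _ => Set.mem_univ _, fun S _ hne hS => ?_⟩
  have := h.2 (e ⁻¹' S) (Set.subset_univ _) (hne.preimage e.surjective)
    (isClosed_preimage_congr e g S hS)
  rw [Set.eq_univ_iff_forall] at this ⊢
  intro w
  simpa using this (e.symm w)

theorem isComponent_univ_congr_iff (e : V ≃ W) (g : BipartiteGEM D V) :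
    g.IsComponent Set.univ ↔ (congr D e g).IsComponent Set.univ := by
  refine ⟨isComponent_univ_congr e g, fun h => ?_⟩
  have h2 := isComponent_univ_congr e.symm _ h
  rwa [show congr D e.symm (congr D e g) = g from (congr D e).left_inv g] at h2

/-- The number of orientable GEMs of size `m`. -/
noncomputable def count (D m : ℕ) : ℕ := Nat.card (BipartiteGEM D (Fin m))

/-- The number of orientable GEMs of size `m` with at most one connected component. -/
noncomputable def connCount (D m : ℕ) : ℕ :=
  Nat.card {g : BipartiteGEM D (Fin m) // g.IsComponent Set.univ}

theorem card_eq_count [Fintype V] : Nat.card (BipartiteGEM D V) = count D (Fintype.card V) :=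
  Nat.card_congr (congr D (Fintype.equivFin V))

theorem card_conn_eq_connCount [Fintype V] :
    Nat.card {g : BipartiteGEM D V // g.IsComponent Set.univ} = connCount D (Fintype.card V) :=
  Nat.card_congr ((congr D (Fintype.equivFin V)).subtypeEquiv
    (isComponent_univ_congr_iff (Fintype.equivFin V)))

theorem connCount_le_count (D m : ℕ) : connCount D m ≤ count D m :=
  Nat.card_le_card_of_injective _ Subtype.val_injective

/-- A gluing is its own inverse, so it cannot enter a closed set from outside; hence complements of
closed sets are closed. -/
theorem IsClosed.glue_mem_iff {g : BipartiteGEM D V} {S : Set V} (h : g.IsClosed S) (c i) :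
    g.glue c i ∈ S ↔ i ∈ S :=
  ⟨fun hi => by simpa [g.glue_glue] using h c _ hi, h c i⟩

theorem IsClosed.inter {g : BipartiteGEM D V} {S T : Set V} (hS : g.IsClosed S)
    (hT : g.IsClosed T) : g.IsClosed (S ∩ T) :=
  fun c i hi => ⟨hS c i hi.1, hT c i hi.2⟩

theorem IsClosed.compl {g : BipartiteGEM D V} {S : Set V} (hS : g.IsClosed S) :
    g.IsClosed Sᶜ :=
  fun c i hi h => hi ((hS.glue_mem_iff c i).1 h)

/-- The component is the closed set of least cardinality containing `v`; uniqueness follows by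
intersecting with any other candidate. -/
theorem existsUnique_isComponent [Finite V] (g : BipartiteGEM D V) (v : V) :
    ∃! K : Finset V, v ∈ K ∧ g.IsComponent (K : Set V) := by
  classical
  have : Fintype V := Fintype.ofFinite V
  obtain ⟨K, hK, hmin⟩ := Finset.exists_min_image
    (Finset.univ.filter fun K : Finset V => v ∈ K ∧ g.IsClosed (K : Set V)) Finset.card
    ⟨Finset.univ, by simp [IsClosed]⟩
  simp only [Finset.mem_filter, Finset.mem_univ, true_and] at hK hmin
  have hmin' : ∀ S ⊆ (K : Set V), v ∈ S → g.IsClosed S → S = K := by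
    intro S hSK hv hS
    have h1 := hmin S.toFinset ⟨by simpa using hv, by simpa using hS⟩
    have h2 : S.toFinset ⊆ K := by
      intro x hx; exact hSK (by simpa using hx)
    rw [← Finset.eq_of_subset_of_card_le h2 h1]
    simp
  refine ⟨K, ⟨hK.1, hK.2, fun S hSK hne hS => ?_⟩, ?_⟩
  · by_cases hv : v ∈ S
    · exact hmin' S hSK hv hS
    -- If `S` misses `v`, then `K \ S` is closed and contains `v`, so it is all of `K` and `S` is
    -- empty.
    · have h3 := hmin' (K ∩ Sᶜ) Set.inter_subset_left ⟨hK.1, hv⟩ (hK.2.inter hS.compl)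
      obtain ⟨x, hx⟩ := hne
      have h4 : x ∈ (K : Set V) ∩ Sᶜ := h3.symm ▸ hSK hx
      exact absurd hx h4.2
  · rintro K' ⟨hv', hc', h'⟩
    have h5 := h' (K' ∩ K) Set.inter_subset_left ⟨v, hv', hK.1⟩ (hc'.inter hK.2)
    have h6 := hmin' (K' ∩ K) Set.inter_subset_right ⟨hv', hK.1⟩ (hc'.inter hK.2)
    exact_mod_cast h5.symm.trans h6

/-- Restriction to a closed set. -/
def restrict (g : BipartiteGEM D V) (p : V → Prop) (h : ∀ c i, p i → p (g.glue c i)) :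
    BipartiteGEM D {i // p i} where
  glue c i := ⟨g.glue c i, h c i i.2⟩
  side i := g.side i
  glue_glue c i := by simp [g.glue_glue]
  side_glue c i := g.side_glue c i

/-- Disjoint union of two orientable GEMs. -/
def glueTogether (p : V → Prop) [DecidablePred p] (g : BipartiteGEM D {i // p i})
    (h : BipartiteGEM D {i // ¬ p i}) : BipartiteGEM D V where
  glue c i := if hi : p i then g.glue c ⟨i, hi⟩ else h.glue c ⟨i, hi⟩
  side i := if hi : p i then g.side ⟨i, hi⟩ else h.side ⟨i, hi⟩
  glue_glue c i := by
    by_cases hi : p i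
    · simp [hi, (g.glue c ⟨i, hi⟩).2, g.glue_glue]
    · simp [hi, (h.glue c ⟨i, hi⟩).2, h.glue_glue]
  side_glue c i := by
    by_cases hi : p i
    · simp [hi, (g.glue c ⟨i, hi⟩).2, g.side_glue]
    · simp [hi, (h.glue c ⟨i, hi⟩).2, h.side_glue]

/-- Splitting off a closed set. -/
def splitEquiv (p : V → Prop) [DecidablePred p] :
    {g : BipartiteGEM D V // ∀ c i, p (g.glue c i) ↔ p i} ≃
      BipartiteGEM D {i // p i} × BipartiteGEM D {i // ¬ p i} where
  toFun g := (g.1.restrict p fun c i => (g.2 c i).2,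
    g.1.restrict (fun i => ¬ p i) fun c i hi h => hi ((g.2 c i).1 h))
  invFun g := ⟨glueTogether p g.1 g.2, fun c i => by
    by_cases hi : p i
    · simp [glueTogether, hi, (g.1.glue c ⟨i, hi⟩).2]
    · simp [glueTogether, hi, (g.2.glue c ⟨i, hi⟩).2]⟩
  left_inv g := by
    apply Subtype.ext
    apply BipartiteGEM.ext <;> · simp [glueTogether, restrict]
  right_inv g := by
    rcases g with ⟨g, h⟩
    apply Prod.ext <;> apply BipartiteGEM.ext
    · funext c i; apply Subtype.ext; simp [glueTogether, restrict, i.2]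
    · funext i; simp [glueTogether, restrict, i.2]
    · funext c i; apply Subtype.ext; simp [glueTogether, restrict, i.2]
    · funext i; simp [glueTogether, restrict, i.2]

theorem isComponent_iff_restrict (g : BipartiteGEM D V) (p : V → Prop)
    (h : ∀ c i, p (g.glue c i) ↔ p i) :
    g.IsComponent {i | p i} ↔
      (g.restrict p fun c i => (h c i).2).IsComponent Set.univ := by
  constructor
  · rintro ⟨_, h2⟩
    refine ⟨fun _ _ _ => Set.mem_univ _, fun S _ hne hS => ?_⟩
    have h3 := h2 (Subtype.val '' S) (by rintro _ ⟨x, -, rfl⟩; exact x.2) (hne.image _) (by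
      rintro c _ ⟨x, hx, rfl⟩
      exact ⟨_, hS c x hx, rfl⟩)
    rw [Set.eq_univ_iff_forall]
    rintro ⟨x, hx⟩
    have h4 : x ∈ Subtype.val '' S := h3 ▸ hx
    obtain ⟨y, hy, e⟩ := h4
    rwa [show (⟨x, hx⟩ : {i // p i}) = y from Subtype.ext e.symm]
  · rintro ⟨_, h2⟩
    refine ⟨fun c i hi => (h c i).2 hi, fun S hSK hne hS => ?_⟩
    have h3 := h2 (Subtype.val ⁻¹' S) (Set.subset_univ _) (by
      obtain ⟨x, hx⟩ := hne
      exact ⟨⟨x, hSK hx⟩, hx⟩) (fun c i hi => hS c i hi)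
    refine Set.Subset.antisymm hSK fun x hx => ?_
    have h4 : (⟨x, hx⟩ : {i // p i}) ∈ (Subtype.val ⁻¹' S : Set {i // p i}) := h3 ▸ Set.mem_univ _
    exact h4

/-- GEMs with a given connected component. -/
def componentEquiv [DecidableEq V] (K : Finset V) :
    {g : BipartiteGEM D V // g.IsComponent (K : Set V)} ≃
      {g : BipartiteGEM D {i // i ∈ K} // g.IsComponent Set.univ} ×
        BipartiteGEM D {i // i ∉ K} :=
  calc {g : BipartiteGEM D V // g.IsComponent (K : Set V)}
      ≃ {g : {g : BipartiteGEM D V // ∀ c i, g.glue c i ∈ K ↔ i ∈ K} //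
          g.1.IsComponent (K : Set V)} :=
        (Equiv.subtypeSubtypeEquivSubtype fun {g} hg c i => by
          simpa using hg.1.glue_mem_iff c i).symm
    _ ≃ {x : BipartiteGEM D {i // i ∈ K} × BipartiteGEM D {i // i ∉ K} //
          x.1.IsComponent Set.univ} :=
        (splitEquiv (fun i => i ∈ K)).subtypeEquiv fun g =>
          isComponent_iff_restrict g.1 (fun i => i ∈ K) g.2
    _ ≃ _ := Equiv.prodSubtypeFstEquivSubtypeProd (p := fun g => IsComponent g Set.univ)

/-- Counting pointed orientable GEMs by the component of the marked simplex. -/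
theorem mul_count (D m : ℕ) : m * count D m =
    ∑ k ∈ Finset.range (m + 1), m.choose k * (k * connCount D k * count D (m - k)) := by
  have h1 : Nat.card (BipartiteGEM D (Fin m) × Fin m) = m * count D m := by
    rw [Nat.card_prod, Nat.card_fin, count, mul_comm]
  rw [← h1, Nat.card_eq_sum_of_existsUnique
    (fun (x : BipartiteGEM D (Fin m) × Fin m) (K : Finset (Fin m)) =>
      x.2 ∈ K ∧ x.1.IsComponent (K : Set (Fin m)))
    (fun x => existsUnique_isComponent x.1 x.2)]
  have h2 : ∀ K : Finset (Fin m), Nat.card {x : BipartiteGEM D (Fin m) × Fin m //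
      x.2 ∈ K ∧ x.1.IsComponent (K : Set (Fin m))} =
      K.card * connCount D K.card * count D (m - K.card) := by
    intro K
    let e : {x : BipartiteGEM D (Fin m) × Fin m //
        x.2 ∈ K ∧ x.1.IsComponent (K : Set (Fin m))} ≃
        {g : BipartiteGEM D (Fin m) // g.IsComponent (K : Set (Fin m))} × {i // i ∈ K} :=
      (Equiv.subtypeEquivRight fun x => and_comm).trans
        (Equiv.subtypeProdEquivProd (p := fun g => IsComponent g (K : Set (Fin m)))
          (q := fun i => i ∈ K))
    rw [Nat.card_congr (e.trans ((componentEquiv K).prodCongr (Equiv.refl _))), Nat.card_prod,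
      Nat.card_prod, card_conn_eq_connCount, card_eq_count, Fintype.card_coe,
      Fintype.card_subtype_notMem, Fintype.card_fin, Nat.card_eq_fintype_card, Fintype.card_coe]
    ring
  rw [Finset.sum_congr rfl fun K _ => h2 K,
    Finset.sum_univ_apply_card (fun k => k * connCount D k * count D (m - k)), Fintype.card_fin]
  rfl

/-- An orientable GEM is given by one side together with bijections to the other side. -/
def equivBijections (D : ℕ) (V : Type*) [Fintype V] [DecidableEq V] :
    {x : BipartiteGEM D V × Finset V // ∀ i, x.1.side i ↔ i ∈ x.2} ≃
      Σ A : Finset V, Fin (D + 1) → ({i // i ∈ A} ≃ {i // i ∉ A}) where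
  toFun x := ⟨x.1.2, fun c =>
    { toFun := fun i => ⟨x.1.1.glue c i, by
        rw [← x.2, x.1.1.side_glue, not_not, x.2]; exact i.2⟩
      invFun := fun i => ⟨x.1.1.glue c i, by
        rw [← x.2, x.1.1.side_glue, x.2]; exact i.2⟩
      left_inv := fun i => by simp [x.1.1.glue_glue]
      right_inv := fun i => by simp [x.1.1.glue_glue] }⟩
  invFun y := ⟨(⟨fun c i => if h : i ∈ y.1 then y.2 c ⟨i, h⟩ else (y.2 c).symm ⟨i, h⟩,
    fun i => i ∈ y.1,
    fun c i => by
      by_cases hi : i ∈ y.1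
      · simp [hi, ((y.2 c) ⟨i, hi⟩).2]
      · simp [hi, ((y.2 c).symm ⟨i, hi⟩).2],
    fun c i => by
      by_cases hi : i ∈ y.1
      · simp [hi, ((y.2 c) ⟨i, hi⟩).2]
      · simp [hi, ((y.2 c).symm ⟨i, hi⟩).2]⟩, y.1), fun _ => Iff.rfl⟩
  left_inv x := by
    apply Subtype.ext
    apply Prod.ext
    · apply BipartiteGEM.ext
      · funext c i
        simp
      · funext i
        simp [x.2]
    · rfl
  right_inv y := by
    rcases y with ⟨A, f⟩
    refine Sigma.ext rfl (heq_of_eq ?_)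
    funext c
    ext i
    simp

theorem card_sideEquiv (D m : ℕ) (A : Finset (Fin m)) :
    Nat.card (Fin (D + 1) → ({i // i ∈ A} ≃ {i // i ∉ A})) =
      if 2 * A.card = m then A.card.factorial ^ (D + 1) else 0 := by
  rw [Nat.card_pi]
  have hA : Fintype.card {i // i ∈ A} = A.card := Fintype.card_coe A
  have hA' := Fintype.card_subtype_notMem A
  rw [Fintype.card_fin] at hA'
  have hle : A.card ≤ m := by simpa using A.card_le_univ
  split_ifs with h
  · have e : {i // i ∈ A} ≃ {i // i ∉ A} := Fintype.equivOfCardEq (by omega)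
    simp [Nat.card_eq_fintype_card, Fintype.card_equiv e]
  · have : IsEmpty ({i // i ∈ A} ≃ {i // i ∉ A}) :=
      ⟨fun e => h (by have := Fintype.card_congr e; omega)⟩
    simp

theorem count_eq_sum (D m : ℕ) : count D m = ∑ k ∈ Finset.range (m + 1),
    m.choose k * if 2 * k = m then k.factorial ^ (D + 1) else 0 := by
  classical
  -- Recording one side redundantly as a `Finset` allows summation over its cardinality.
  let e : BipartiteGEM D (Fin m) ≃
      {x : BipartiteGEM D (Fin m) × Finset (Fin m) // ∀ i, x.1.side i ↔ i ∈ x.2} :=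
    { toFun := fun g => ⟨(g, Finset.univ.filter g.side), by simp⟩
      invFun := fun x => x.1.1
      left_inv := fun _ => rfl
      right_inv := fun x => by
        apply Subtype.ext
        apply Prod.ext
        · rfl
        · ext i; simp [x.2] }
  rw [count, Nat.card_congr (e.trans (equivBijections D (Fin m))), Nat.card_sigma,
    Finset.sum_congr rfl fun A _ => card_sideEquiv D m A,
    Finset.sum_univ_apply_card (fun k => if 2 * k = m then k.factorial ^ (D + 1) else 0),
    Fintype.card_fin]
  rfl

theorem count_two_mul (D n : ℕ) :
    count D (2 * n) = (2 * n).choose n * n.factorial ^ (D + 1) := by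
  rw [count_eq_sum, Finset.sum_eq_single n]
  · simp
  · intro k _ hk
    rw [if_neg (by omega), mul_zero]
  · intro h; simp at h; omega

theorem count_of_odd {D m : ℕ} (hm : Odd m) : count D m = 0 := by
  rw [count_eq_sum]
  refine Finset.sum_eq_zero fun k _ => ?_
  rw [if_neg, mul_zero]
  rintro rfl
  exact (Nat.not_odd_iff_even.2 (even_two_mul k)) hm

end BipartiteGEM

/-! ### Comparison with `OGEM` and graph connectivity -/

/-- Forgetting the labelling convention. -/
def OGEM.equivBipartiteGEM (D m : ℕ) : OGEM D m ≃ BipartiteGEM D (Fin m) where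
  toFun g := ⟨fun c => g.glue c, fun i => i ∈ g.A, g.glue_glue, g.glue_mem_iff⟩
  invFun g := ⟨⟨fun c => Function.Involutive.toPerm (g.glue c) (g.glue_glue c), g.glue_glue,
    fun c i h => by
      -- A fixed simplex would lie on both sides, so freeness of the gluings is automatic.
      have h1 := g.side_glue c i
      have h2 : g.glue c i = i := h
      rw [h2] at h1
      tauto⟩, {i | g.side i}, g.side_glue⟩
  left_inv g := by
    apply OGEM.ext
    · funext c; ext i; rfl
    · rfl
  right_inv g := rfl

/-- Closed sets propagate along walks, and reachable sets are closed. Size `0` is excluded because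
there `IsComponent` holds vacuously while the empty graph is not connected. -/
theorem OGEM.connected_iff {D m : ℕ} (hm : 0 < m) (g : OGEM D m) :
    g.toGEM.Connected ↔ (OGEM.equivBipartiteGEM D m g).IsComponent Set.univ := by
  constructor
  · intro h
    refine ⟨fun _ _ _ => Set.mem_univ _, fun S _ hne hS => ?_⟩
    obtain ⟨v, hv⟩ := hne
    rw [Set.eq_univ_iff_forall]
    intro w
    obtain ⟨p⟩ := h.preconnected v w
    induction p with
    | nil => exact hv
    | cons hadj _ ih =>
      obtain ⟨c, rfl⟩ := hadj
      exact ih (hS c _ hv)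
  · intro h
    have : Nonempty (Fin m) := ⟨⟨0, hm⟩⟩
    refine (SimpleGraph.connected_iff _).2 ⟨fun v w => ?_, this⟩
    have h1 := h.2 {w | g.toGEM.graph.Reachable v w} (Set.subset_univ _)
      ⟨v, SimpleGraph.Reachable.refl v⟩
      (fun c i hi => SimpleGraph.Reachable.trans hi (SimpleGraph.Adj.reachable ⟨c, rfl⟩))
    exact (Set.eq_univ_iff_forall.1 h1) w

theorem probConnected_eq {D m : ℕ} (hm : 0 < m) : probConnected D m =
    (BipartiteGEM.connCount D m : ℝ) / (BipartiteGEM.count D m : ℝ) := by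
  rw [probConnected, BipartiteGEM.count, BipartiteGEM.connCount,
    Nat.card_congr (OGEM.equivBipartiteGEM D m),
    Nat.card_congr ((OGEM.equivBipartiteGEM D m).subtypeEquiv
      (q := fun g => g.IsComponent Set.univ) (OGEM.connected_iff hm))]

/-! ### Multiple linear orders and their first irreducible block -/

/-- A `d`-tuple of strict linear orders on an arbitrary type. -/
@[ext] structure MultiOrder (d : ℕ) (V : Type*) where
  lt : Fin d → V → V → Prop
  irrefl : ∀ j a, ¬ lt j a a
  trans : ∀ j a b c, lt j a b → lt j b c → lt j a c
  total : ∀ j a b, a ≠ b → lt j a b ∨ lt j b a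

namespace MultiOrder

variable {d : ℕ} {V W : Type*}

instance [Finite V] : Finite (MultiOrder d V) :=
  Finite.of_injective MultiOrder.lt fun _ _ e => MultiOrder.ext e

theorem asymm (L : MultiOrder d V) {j : Fin d} {a b : V} (h : L.lt j a b) : ¬ L.lt j b a :=
  fun h' => L.irrefl j a (L.trans j a b a h h')

/-- A set is initial if its elements precede all the others in all the orders. -/
def IsInitial (L : MultiOrder d V) (A : Set V) : Prop := ∀ a ∈ A, ∀ b ∉ A, ∀ j, L.lt j a b

/-- The minimal nonempty initial sets. -/
def IsFirstBlock (L : MultiOrder d V) (A : Set V) : Prop :=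
  A.Nonempty ∧ L.IsInitial A ∧ ∀ B ⊆ A, B.Nonempty → L.IsInitial B → B = A

/-- There is no proper nonempty initial set. -/
def Irreducible (L : MultiOrder d V) : Prop :=
  ∀ B : Set V, B.Nonempty → L.IsInitial B → B = Set.univ

variable (d) in
/-- Transport of structure along a bijection of the ground sets. -/
def congr (e : V ≃ W) : MultiOrder d V ≃ MultiOrder d W where
  toFun L := ⟨fun j a b => L.lt j (e.symm a) (e.symm b), fun _ _ => L.irrefl _ _,
    fun _ _ _ _ => L.trans _ _ _ _, fun _ _ _ h => L.total _ _ _ (by simpa using h)⟩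
  invFun L := ⟨fun j a b => L.lt j (e a) (e b), fun _ _ => L.irrefl _ _,
    fun _ _ _ _ => L.trans _ _ _ _, fun _ _ _ h => L.total _ _ _ (by simpa using h)⟩
  left_inv L := by ext; simp
  right_inv L := by ext; simp

theorem irreducible_congr (e : V ≃ W) (L : MultiOrder d V) (h : L.Irreducible) :
    (congr d e L).Irreducible := by
  intro B hne hB
  have := h (e ⁻¹' B) (hne.preimage e.surjective) (fun a ha b hb j => by
    simpa [congr] using hB (e a) ha (e b) hb j)
  rw [Set.eq_univ_iff_forall] at this ⊢
  intro w
  simpa using this (e.symm w)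

theorem irreducible_congr_iff (e : V ≃ W) (L : MultiOrder d V) :
    L.Irreducible ↔ (congr d e L).Irreducible := by
  refine ⟨irreducible_congr e L, fun h => ?_⟩
  have h2 := irreducible_congr e.symm _ h
  rwa [show congr d e.symm (congr d e L) = L from (congr d e).left_inv L] at h2

/-- A multiple linear order in the sense of Mathlib is a tuple of strict orders. -/
noncomputable def equivMultiLinearOrder (d k : ℕ) :
    MultiLinearOrder d k ≃ MultiOrder d (Fin k) where
  toFun L := ⟨fun j => (L j).lt, fun j a => @lt_irrefl _ (L j).toPreorder a,
    fun j a b c => @lt_trans _ (L j).toPreorder a b c,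
    fun j a b h => @lt_or_gt_of_ne _ (L j) a b h⟩
  invFun L := fun j =>
    letI := Classical.decRel (L.lt j)
    haveI : IsStrictTotalOrder (Fin k) (L.lt j) :=
      { trichotomous := fun a b h h' => by
          by_contra hne
          exact (L.total j a b hne).elim h h'
        irrefl := L.irrefl j
        trans := L.trans j }
    linearOrderOfSTO (L.lt j)
  left_inv L := by
    funext j
    exact LinearOrder.ext_lt fun a b => Iff.rfl
  right_inv L := rfl

theorem not_reducible_iff {k : ℕ} (L : MultiLinearOrder d k) :
    ¬ L.Reducible ↔ (equivMultiLinearOrder d k L).Irreducible := by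
  constructor
  · intro h B hne hB
    by_contra hu
    exact h ⟨B, hne, Set.nonempty_compl.2 hu, hB⟩
  · rintro h ⟨A, hne, hne', hA⟩
    exact Set.nonempty_compl.1 hne' (h A hne hA)

theorem card_irreducible [Fintype V] :
    Nat.card {L : MultiOrder d V // L.Irreducible} = il d (Fintype.card V) := by
  rw [il, Nat.card_congr ((equivMultiLinearOrder d _).subtypeEquiv
      (q := fun L => L.Irreducible) not_reducible_iff)]
  exact Nat.card_congr ((congr d (Fintype.equivFin V)).subtypeEquiv
    (irreducible_congr_iff (Fintype.equivFin V)))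

theorem exists_equiv_fin [Fintype V] {k : ℕ} (L : MultiOrder d V) (hk : Fintype.card V = k)
    (j : Fin d) : ∃ e : V ≃ Fin k, ∀ a b, L.lt j a b ↔ e a < e b := by
  classical
  have : IsStrictTotalOrder V (L.lt j) :=
    { trichotomous := fun a b h h' => by
        by_contra hne
        exact (L.total j a b hne).elim h h'
      irrefl := L.irrefl j
      trans := L.trans j }
  let _ : LinearOrder V := linearOrderOfSTO (L.lt j)
  let e := Fintype.orderIsoFinOfCardEq V hk
  exact ⟨e.symm.toEquiv, fun a b => (e.symm.lt_iff_lt (x := a) (y := b)).symm⟩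

/-- A strict linear order on `k` labels amounts to an enumeration of the labels. -/
noncomputable def permEquivOneOrder (k : ℕ) : Equiv.Perm (Fin k) ≃ MultiOrder 1 (Fin k) :=
  Equiv.ofBijective
    (fun s => ⟨fun _ a b => s a < s b, fun _ _ => lt_irrefl _, fun _ _ _ _ => lt_trans,
      fun _ _ _ h => lt_or_gt_of_ne (s.injective.ne h)⟩) (by
    constructor
    · intro s t h
      have h1 : ∀ a b, s a < s b ↔ t a < t b := fun a b =>
        iff_of_eq (congrFun (congrFun (congrFun (congrArg MultiOrder.lt h) 0) a) b)
      have h2 : ∀ {a b}, (s.symm.trans t) a ≤ (s.symm.trans t) b ↔ a ≤ b := by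
        intro a b
        rw [← not_lt, ← not_lt]
        simpa using not_congr (h1 (s.symm b) (s.symm a)).symm
      -- A finite linear order has no automorphism but the identity.
      have h3 : (⟨s.symm.trans t, h2⟩ : Fin k ≃o Fin k) = OrderIso.refl _ :=
        Subsingleton.elim _ _
      ext a
      have h4 := DFunLike.congr_fun h3 (s a)
      have h5 : t (s.symm (s a)) = s a := h4
      rw [Equiv.symm_apply_apply] at h5
      rw [h5]
    · intro L
      obtain ⟨e, he⟩ := L.exists_equiv_fin (Fintype.card_fin k) 0
      refine ⟨e, ?_⟩
      ext j a b
      rw [Subsingleton.elim j 0]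
      exact (he a b).symm)

/-- A multiple order is a tuple of orders. -/
def equivPi (d : ℕ) (V : Type*) : MultiOrder d V ≃ (Fin d → MultiOrder 1 V) where
  toFun L j := ⟨fun _ => L.lt j, fun _ => L.irrefl j, fun _ => L.trans j, fun _ => L.total j⟩
  invFun M := ⟨fun j => (M j).lt 0, fun j => (M j).irrefl 0, fun j => (M j).trans 0,
    fun j => (M j).total 0⟩
  left_inv L := rfl
  right_inv M := by
    funext j
    ext i a b
    rw [Subsingleton.elim i 0]

theorem card_multiOrder [Fintype V] :
    Nat.card (MultiOrder d V) = (Fintype.card V).factorial ^ d := by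
  rw [Nat.card_congr ((congr d (Fintype.equivFin V)).trans (equivPi d _)), Nat.card_pi]
  simp only [← Nat.card_congr (permEquivOneOrder _), Nat.card_perm, Nat.card_fin]
  simp

theorem IsInitial.inter {L : MultiOrder d V} {A B : Set V} (hA : L.IsInitial A)
    (hB : L.IsInitial B) : L.IsInitial (A ∩ B) := by
  intro a ha b hb j
  by_cases h : b ∈ A
  · exact hB a ha.2 b (fun h' => hb ⟨h, h'⟩) j
  · exact hA a ha.1 b h j

/-- If disjoint, an element of each would precede the other in the same order; one order is enough.
This yields uniqueness of the first block. -/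
theorem IsInitial.inter_nonempty {L : MultiOrder d V} (hd : 0 < d) {A B : Set V}
    (hA : L.IsInitial A) (hB : L.IsInitial B) (hA' : A.Nonempty) (hB' : B.Nonempty) :
    (A ∩ B).Nonempty := by
  obtain ⟨a, ha⟩ := hA'
  obtain ⟨b, hb⟩ := hB'
  by_cases h : a ∈ B
  · exact ⟨a, ha, h⟩
  by_cases h' : b ∈ A
  · exact ⟨b, h', hb⟩
  · exact absurd (hB b hb a h ⟨0, hd⟩) (L.asymm (hA a ha b h' ⟨0, hd⟩))

theorem existsUnique_isFirstBlock [Finite V] [Nonempty V] (hd : 0 < d) (L : MultiOrder d V) :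
    ∃! A : Finset V, L.IsFirstBlock (A : Set V) := by
  classical
  have : Fintype V := Fintype.ofFinite V
  obtain ⟨A, hA, hmin⟩ := Finset.exists_min_image
    (Finset.univ.filter fun A : Finset V => (A : Set V).Nonempty ∧ L.IsInitial (A : Set V))
    Finset.card ⟨Finset.univ, by simp [IsInitial]⟩
  simp only [Finset.mem_filter, Finset.mem_univ, true_and] at hA hmin
  have hmin' : ∀ S ⊆ (A : Set V), S.Nonempty → L.IsInitial S → S = A := by
    intro S hSA hne hS
    have h1 := hmin S.toFinset ⟨by simpa using hne, by simpa using hS⟩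
    have h2 : S.toFinset ⊆ A := by
      intro x hx; exact hSA (by simpa using hx)
    rw [← Finset.eq_of_subset_of_card_le h2 h1]
    simp
  refine ⟨A, ⟨hA.1, hA.2, hmin'⟩, ?_⟩
  rintro B ⟨hne, hB, h'⟩
  have hI := hB.inter_nonempty hd hA.2 hne hA.1
  have h5 := h' (B ∩ A) Set.inter_subset_left hI (hB.inter hA.2)
  have h6 := hmin' (B ∩ A) Set.inter_subset_right hI (hB.inter hA.2)
  exact_mod_cast h5.symm.trans h6

/-- Restriction to a subset. -/
def restrict (L : MultiOrder d V) (p : V → Prop) : MultiOrder d {i // p i} :=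
  ⟨fun j a b => L.lt j a b, fun _ _ => L.irrefl _ _, fun _ _ _ _ => L.trans _ _ _ _,
    fun _ _ _ h => L.total _ _ _ fun h' => h (Subtype.ext h')⟩

/-- Ordinal sum of two multiple orders. -/
def ordinalSum (p : V → Prop) [DecidablePred p] (L : MultiOrder d {i // p i})
    (M : MultiOrder d {i // ¬ p i}) : MultiOrder d V where
  lt j a b :=
    if ha : p a then if hb : p b then L.lt j ⟨a, ha⟩ ⟨b, hb⟩ else True
    else if hb : p b then False else M.lt j ⟨a, ha⟩ ⟨b, hb⟩
  irrefl j a := by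
    by_cases ha : p a
    · simpa [ha] using L.irrefl _ _
    · simpa [ha] using M.irrefl _ _
  trans j a b c := by
    by_cases ha : p a <;> by_cases hb : p b <;> by_cases hc : p c <;> simp [ha, hb, hc]
    · exact L.trans _ _ _ _
    · exact M.trans _ _ _ _
  total j a b h := by
    by_cases ha : p a <;> by_cases hb : p b <;> simp [ha, hb]
    · exact L.total _ _ _ (by simpa using h)
    · exact M.total _ _ _ (by simpa using h)

/-- Splitting off an initial set. -/
def splitEquiv (p : V → Prop) [DecidablePred p] :
    {L : MultiOrder d V // L.IsInitial {i | p i}} ≃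
      MultiOrder d {i // p i} × MultiOrder d {i // ¬ p i} where
  toFun L := (L.1.restrict p, L.1.restrict fun i => ¬ p i)
  invFun L := ⟨ordinalSum p L.1 L.2, fun a ha b hb j => by
    have ha' : p a := ha
    have hb' : ¬ p b := hb
    simp [ordinalSum, ha', hb']⟩
  left_inv L := by
    apply Subtype.ext
    ext j a b
    by_cases ha : p a <;> by_cases hb : p b <;> simp [ordinalSum, restrict, ha, hb]
    · exact L.2 a ha b hb j
    · exact L.1.asymm (L.2 b hb a ha j)
  right_inv L := by
    rcases L with ⟨L, M⟩
    apply Prod.ext <;> ext j a b <;> simp [ordinalSum, restrict, a.2, b.2]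

/-- Everything outside an initial set comes after it, so a subset is initial in the whole exactly
when it is initial within the restriction. -/
theorem isFirstBlock_iff_restrict (L : MultiOrder d V) (p : V → Prop) (hp : ∃ i, p i)
    (h : L.IsInitial {i | p i}) :
    L.IsFirstBlock {i | p i} ↔ (L.restrict p).Irreducible := by
  constructor
  · rintro ⟨_, _, h2⟩ B hne hB
    have h3 := h2 (Subtype.val '' B) (by rintro _ ⟨x, -, rfl⟩; exact x.2) (hne.image _) (by
      rintro _ ⟨a, ha, rfl⟩ b hb j
      by_cases hpb : p b
      · exact hB a ha ⟨b, hpb⟩ (fun h => hb ⟨_, h, rfl⟩) j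
      · exact h a a.2 b hpb j)
    rw [Set.eq_univ_iff_forall]
    rintro ⟨x, hx⟩
    have h4 : x ∈ Subtype.val '' B := h3 ▸ hx
    obtain ⟨y, hy, e⟩ := h4
    rwa [show (⟨x, hx⟩ : {i // p i}) = y from Subtype.ext e.symm]
  · intro h2
    refine ⟨hp, h, fun B hBp hne hB => ?_⟩
    have h3 := h2 (Subtype.val ⁻¹' B) (by
      obtain ⟨x, hx⟩ := hne
      exact ⟨⟨x, hBp hx⟩, hx⟩) (fun a ha b hb j => hB a ha b hb j)
    refine Set.Subset.antisymm hBp fun x hx => ?_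
    have h4 : (⟨x, hx⟩ : {i // p i}) ∈ (Subtype.val ⁻¹' B : Set {i // p i}) := h3 ▸ Set.mem_univ _
    exact h4

/-- Multiple orders with a given first block. -/
def firstBlockEquiv [DecidableEq V] (A : Finset V) (hA : A.Nonempty) :
    {L : MultiOrder d V // L.IsFirstBlock (A : Set V)} ≃
      {L : MultiOrder d {i // i ∈ A} // L.Irreducible} × MultiOrder d {i // i ∉ A} :=
  calc {L : MultiOrder d V // L.IsFirstBlock (A : Set V)}
      ≃ {L : {L : MultiOrder d V // L.IsInitial {i | i ∈ A}} //
          L.1.IsFirstBlock (A : Set V)} :=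
        (Equiv.subtypeSubtypeEquivSubtype fun hL => hL.2.1).symm
    _ ≃ {x : MultiOrder d {i // i ∈ A} × MultiOrder d {i // i ∉ A} // x.1.Irreducible} :=
        (splitEquiv (fun i => i ∈ A)).subtypeEquiv fun L =>
          isFirstBlock_iff_restrict L.1 (fun i => i ∈ A) hA L.2
    _ ≃ _ := Equiv.prodSubtypeFstEquivSubtypeProd (p := fun L => Irreducible L)

end MultiOrder

/-- Counting multiple linear orders by their first irreducible block. -/
theorem factorial_pow_eq_sum_il {d m : ℕ} (hd : 0 < d) (hm : 0 < m) : m.factorial ^ d =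
    ∑ k ∈ Finset.range (m + 1),
      m.choose k * if k = 0 then 0 else il d k * (m - k).factorial ^ d := by
  have : Nonempty (Fin m) := ⟨⟨0, hm⟩⟩
  have h1 : Nat.card (MultiOrder d (Fin m)) = m.factorial ^ d := by
    rw [MultiOrder.card_multiOrder, Fintype.card_fin]
  rw [← h1, Nat.card_eq_sum_of_existsUnique
    (fun (L : MultiOrder d (Fin m)) (A : Finset (Fin m)) => L.IsFirstBlock (A : Set (Fin m)))
    (MultiOrder.existsUnique_isFirstBlock hd)]
  have h2 : ∀ A : Finset (Fin m),
      Nat.card {L : MultiOrder d (Fin m) // L.IsFirstBlock (A : Set (Fin m))} =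
      if A.card = 0 then 0 else il d A.card * (m - A.card).factorial ^ d := by
    intro A
    rcases A.eq_empty_or_nonempty with rfl | hA
    · simp [MultiOrder.IsFirstBlock]
    · rw [Nat.card_congr (MultiOrder.firstBlockEquiv A hA), Nat.card_prod,
        MultiOrder.card_irreducible, MultiOrder.card_multiOrder, Fintype.card_coe,
        Fintype.card_subtype_notMem, Fintype.card_fin, if_neg hA.card_pos.ne']
  rw [Finset.sum_congr rfl fun A _ => h2 A,
    Finset.sum_univ_apply_card (fun k => if k = 0 then 0 else il d k * (m - k).factorial ^ d),
    Fintype.card_fin]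
  rfl

/-- A linear order together with its reverse is irreducible. -/
theorem il_pos {d : ℕ} (hd : 2 ≤ d) (k : ℕ) : 0 < il d k := by
  have h := MultiOrder.card_irreducible (d := d) (V := Fin k)
  rw [Fintype.card_fin] at h
  rw [← h]
  -- Order `0` is the usual one and all the others are reversed; orders `0` and `1` already
  -- contradict any proper initial set.
  refine Nat.card_pos_iff.2 ⟨⟨⟨⟨fun j a b => if (j : ℕ) = 0 then a < b else b < a, ?_, ?_, ?_⟩,
    ?_⟩⟩, inferInstance⟩
  · intro j a; simp
  · intro j a b c; split_ifs <;> omega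
  · intro j a b; split_ifs <;> omega
  · intro B hne hB
    obtain ⟨a, ha⟩ := hne
    by_contra hu
    obtain ⟨b, hb⟩ := Set.nonempty_compl.2 hu
    have h1 := hB a ha b hb ⟨0, by omega⟩
    have h2 := hB a ha b hb ⟨1, by omega⟩
    simp at h1 h2
    omega

/-! ### Normalised counts and the recurrence for connected GEMs -/

theorem Finset.sum_range_two_mul_add_one_of_odd {M : Type*} [AddCommMonoid M] (f : ℕ → M)
    (hf : ∀ k, Odd k → f k = 0) (n : ℕ) :
    ∑ k ∈ Finset.range (2 * n + 1), f k = ∑ k ∈ Finset.range (n + 1), f (2 * k) := by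
  induction n with
  | zero => simp
  | succ n ih =>
    rw [show 2 * (n + 1) + 1 = 2 * n + 1 + 1 + 1 by ring, Finset.sum_range_succ,
      Finset.sum_range_succ, ih, hf (2 * n + 1) ⟨n, rfl⟩, add_zero,
      Finset.sum_range_succ _ (n + 1)]
    rfl

theorem Nat.cast_choose_mul_div_factorial {m k : ℕ} (hk : k ≤ m) (x y : ℝ) :
    (m.choose k : ℝ) * (x * y) / m.factorial =
      x / k.factorial * (y / (m - k).factorial) := by
  rw [Nat.cast_choose ℝ hk]
  have := Nat.cast_ne_zero (R := ℝ).2 m.factorial_ne_zero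
  field_simp

namespace BipartiteGEM

theorem count_two_mul_div {D : ℕ} (hD : 1 ≤ D) (n : ℕ) :
    (count D (2 * n) : ℝ) / (2 * n).factorial = (n.factorial : ℝ) ^ (D - 1) := by
  have h : (2 * n).choose n * n.factorial * n.factorial = (2 * n).factorial := by
    have := Nat.choose_mul_factorial_mul_factorial (show n ≤ 2 * n by omega)
    rwa [show 2 * n - n = n by omega] at this
  rw [div_eq_iff (by positivity), count_two_mul, ← h, show D + 1 = (D - 1) + 1 + 1 by omega]
  push_cast
  ring

/-- The coefficients of the generating function of connected orientable GEMs. -/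
noncomputable def connCoeff (D n : ℕ) : ℝ := (connCount D (2 * n) : ℝ) / (2 * n).factorial

theorem connCoeff_nonneg (D n : ℕ) : 0 ≤ connCoeff D n := by
  rw [connCoeff]; positivity

theorem connCoeff_le {D : ℕ} (hD : 1 ≤ D) (n : ℕ) :
    connCoeff D n ≤ (n.factorial : ℝ) ^ (D - 1) := by
  rw [connCoeff, ← count_two_mul_div hD]
  gcongr
  exact connCount_le_count _ _

theorem mul_factorial_pow_eq_sum {D : ℕ} (hD : 1 ≤ D) (n : ℕ) :
    (n : ℝ) * (n.factorial : ℝ) ^ (D - 1) = ∑ k ∈ Finset.range (n + 1),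
      k * connCoeff D k * ((n - k).factorial : ℝ) ^ (D - 1) := by
  have h := congrArg (fun x : ℕ => (x : ℝ) / (2 * n).factorial) (mul_count D (2 * n))
  simp only [Nat.cast_sum, Nat.cast_mul, Finset.sum_div] at h
  rw [Finset.sum_congr rfl fun k hk => Nat.cast_choose_mul_div_factorial
    (Nat.lt_succ_iff.1 (Finset.mem_range.1 hk)) _ _,
    Finset.sum_range_two_mul_add_one_of_odd, mul_div_assoc, count_two_mul_div hD] at h
  -- A component of size `2 * k` can be marked in `2 * k` ways; the common factor `2` cancels
  -- against the one in `2 * n`.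
  · have h2 : ∀ k ∈ Finset.range (n + 1),
        ((2 * k : ℕ) : ℝ) * connCount D (2 * k) / (2 * k).factorial *
          (count D (2 * n - 2 * k) / (2 * n - 2 * k).factorial) =
        2 * (k * connCoeff D k * ((n - k).factorial : ℝ) ^ (D - 1)) := by
      intro k _
      rw [← Nat.mul_sub, count_two_mul_div hD, connCoeff]
      push_cast
      ring
    rw [Finset.sum_congr rfl h2, ← Finset.mul_sum] at h
    push_cast at h
    linarith
  · intro k hk
    have : connCount D k = 0 := Nat.le_zero.1 ((connCount_le_count D k).trans (count_of_odd hk).le)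
    simp [this]

theorem probConnected_two_mul {D n : ℕ} (hD : 1 ≤ D) (hn : 0 < n) :
    probConnected D (2 * n) = connCoeff D n / (n.factorial : ℝ) ^ (D - 1) := by
  rw [probConnected_eq (by omega), connCoeff, ← count_two_mul_div hD,
    div_div_div_cancel_right₀ (by positivity)]

end BipartiteGEM

/-! ### The inverse series and the final expansion -/

/-- The coefficients of the inverse of the generating function of multiple linear orders. -/
noncomputable def ilCoeff (d k : ℕ) : ℝ :=
  if k = 0 then 1 else - ((il d k : ℝ) / k.factorial)

theorem ilCoeff_ne_zero {d : ℕ} (hd : 2 ≤ d) (k : ℕ) : ilCoeff d k ≠ 0 := by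
  rw [ilCoeff]
  split_ifs
  · exact one_ne_zero
  · have := il_pos hd k
    exact neg_ne_zero.2 (by positivity)

/-- First-block decomposition divided by `n!`. This lowers the exponent from `d` to `d - 1`, so for
`d = D` the series inverted is the one counting GEMs. -/
theorem sum_ilCoeff {d n : ℕ} (hd : 1 ≤ d) (hn : 1 ≤ n) :
    ∑ i ∈ Finset.range (n + 1), ilCoeff d i * ((n - i).factorial : ℝ) ^ (d - 1) = 0 := by
  have hpow : ∀ k : ℕ, (k.factorial : ℝ) ^ d / k.factorial = (k.factorial : ℝ) ^ (d - 1) := by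
    intro k
    rw [div_eq_iff (by positivity), ← pow_succ, Nat.sub_add_cancel hd]
  have h := congrArg (fun x : ℕ => (x : ℝ) / n.factorial) (factorial_pow_eq_sum_il hd hn)
  simp only [Nat.cast_sum, Nat.cast_mul, Nat.cast_pow, Finset.sum_div, hpow] at h
  have h2 : ∀ i ∈ Finset.range (n + 1), ilCoeff d i * ((n - i).factorial : ℝ) ^ (d - 1) =
      (if i = 0 then (n.factorial : ℝ) ^ (d - 1) else 0) - (n.choose i : ℝ) *
        ((if i = 0 then 0 else il d i * (n - i).factorial ^ d : ℕ) : ℝ) / n.factorial := by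
    intro i hi
    rw [ilCoeff]
    split_ifs with h0
    · simp [h0]
    · rw [Nat.cast_mul, Nat.cast_choose_mul_div_factorial
        (Nat.lt_succ_iff.1 (Finset.mem_range.1 hi)), Nat.cast_pow, hpow]
      ring
  rw [Finset.sum_congr rfl h2, Finset.sum_sub_distrib, ← h, Finset.sum_ite_eq']
  simp

/-- The bound `k ≤ n` keeps the falling factorial nonzero; an identity for large `n` suffices for
the asymptotics. -/
theorem expansion_term_eq (D : ℕ) {k n : ℕ} (hk : k ≤ n) :
    (if k = 0 then 1
      else - ((il D k : ℝ) / ((k.factorial : ℝ) * ((n.descFactorial k : ℕ) : ℝ) ^ (D - 1)))) =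
      ilCoeff D k * ((n - k).factorial : ℝ) ^ (D - 1) / (n.factorial : ℝ) ^ (D - 1) := by
  have h : (n.factorial : ℝ) = (n - k).factorial * n.descFactorial k := by
    exact_mod_cast (Nat.factorial_mul_descFactorial hk).symm
  have h1 : ((n.descFactorial k : ℕ) : ℝ) ≠ 0 := by
    exact_mod_cast (Nat.descFactorial_pos.2 hk).ne'
  rw [ilCoeff]
  split_ifs with h0
  · subst h0
    rw [one_mul, Nat.sub_zero, div_self (by positivity)]
  · rw [h, mul_pow]
    field_simp

theorem factorial_pow_isLittleO {d : ℕ} (hd : 1 ≤ d) (k : ℕ) :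
    (fun n : ℕ => ((n - (k + 1)).factorial : ℝ) ^ d) =o[atTop]
      fun n => ((n - k).factorial : ℝ) ^ d := by
  have h1 : (fun _ : ℕ => (1 : ℝ)) =o[atTop] fun n => ((n - k : ℕ) : ℝ) ^ d := by
    rw [isLittleO_one_left_iff]
    refine tendsto_norm_atTop_atTop.comp ((tendsto_pow_atTop (by omega)).comp ?_)
    exact tendsto_natCast_atTop_atTop.comp (tendsto_sub_atTop_nat k)
  refine (h1.mul_isBigO (isBigO_refl (fun n : ℕ => ((n - (k + 1)).factorial : ℝ) ^ d)
    atTop)).congr' ?_ ?_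
  · exact Eventually.of_forall fun n => one_mul _
  · filter_upwards [eventually_ge_atTop (k + 1)] with n hn
    rw [← mul_pow, show n - k = (n - (k + 1)) + 1 by omega, Nat.factorial_succ]
    push_cast
    rfl

theorem mainTheorem9 (D : ℕ) (hD : 2 ≤ D) :
    HasAsymptoticExpansion (fun n => probConnected D (2 * n)) 0
      (fun k n => if k = 0 then 1
        else - ((il D k : ℝ) / ((k.factorial : ℝ) * ((n.descFactorial k : ℕ) : ℝ) ^ (D - 1)))) := by
  have hterm : ∀ k, (fun n : ℕ => if k = 0 then (1 : ℝ)
        else - ((il D k : ℝ) / ((k.factorial : ℝ) * ((n.descFactorial k : ℕ) : ℝ) ^ (D - 1))))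
      =ᶠ[atTop] fun n => ilCoeff D k * ((n - k).factorial : ℝ) ^ (D - 1) *
        ((n.factorial : ℝ) ^ (D - 1))⁻¹ := by
    intro k
    filter_upwards [eventually_ge_atTop k] with n hn
    rw [expansion_term_eq D hn, div_eq_mul_inv]
  constructor
  · intro r _
    have h := log_coeff_sub_sum_isBigO (d := D - 1) (by omega)
      (BipartiteGEM.connCoeff_nonneg D) (BipartiteGEM.connCoeff_le (by omega))
      (BipartiteGEM.mul_factorial_pow_eq_sum (by omega)) (e := ilCoeff D) (by simp [ilCoeff])
      (fun n hn => sum_ilCoeff (by omega) hn) (r + 1) (by omega)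
    -- The nonzero coefficient inserted on the right turns the bound `g (n - (r + 1))`, divided by
    -- `g n`, into the next term of the expansion.
    refine (((h.const_mul_right (ilCoeff_ne_zero hD (r + 1))).mul (isBigO_refl
      (fun n : ℕ => ((n.factorial : ℝ) ^ (D - 1))⁻¹) atTop)).congr' ?_ (hterm (r + 1)).symm)
    filter_upwards [eventually_ge_atTop (r + 1)] with n hn
    rw [BipartiteGEM.probConnected_two_mul (by omega) (by omega), sub_mul, Finset.sum_mul,
      ← div_eq_mul_inv]
    congr 1
    refine Finset.sum_congr (by ext; simp) fun k hk => ?_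
    rw [expansion_term_eq D (by simp at hk; omega), div_eq_mul_inv]
  · intro k _
    refine IsLittleO.congr' ?_ (hterm (k + 1)).symm (hterm k).symm
    refine IsLittleO.mul_isBigO ?_ (isBigO_refl _ _)
    exact ((factorial_pow_isLittleO (by omega) k).const_mul_left _).const_mul_right
      (ilCoeff_ne_zero hD k)
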